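/- All graphs are finite, simple and undirected. Let $G$ be a connected graph. A path between two vertices is a geodesic if it has the shortest possible length, and a path in an edge-coloured graph is rainbow if its edges have distinct colours. An edge-colouring (not necessarily proper) of $G$ is rainbow connected (respectively strongly rainbow connected) if any two vertices are joined by a rainbow path (respectively a rainbow geodesic). Let $src(G)$ be the minimum integer $r\ge 1$ such that $G$ has a strongly rainbow connected edge-colouring with colours in $\{1,\dots,r\}$. Let $rc^\ell(G)$ (respectively $src^\ell(G)$) be the minimum integer $r\ge 1$ such that, whenever every edge $e$ is given a list $L(e)\subseteq\mathbb N$ with at least $r$ elements, there is a rainbow connected (respectively strongly rainbow connected) edge-colouring $c$ of $G$ with $c(e)\in L(e)$ for every edge $e$. **Theorem.** There exist connected graphs $G$ and $H$ such that $H$ is a spanning subgraph of $G$ and $src^\ell(G)>src^\ell(H)$. More precisely, let $H$ be the graph with $10$ vertices and $12$ edges consisting of two vertices $u,v$ with exactly four common neighbours $w_1,\dots,w_4$, two pendent vertices attached to $u$ and two pendent vertices attached to $v$ (and no further edges), and let $G$ be obtained from $H$ by adding the edge $uv$. Then $G$ and $H$ are connected, $src(H)=src^\ell(H)=4$ and $src(G)\ge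 5$, and $src^\ell(G)>src^\ell(H)$. In contrast, $rc^\ell(G)\le rc^\ell(H)$ whenever $G$ is a connected graph and $H$ is a connected spanning subgraph of $G$. -/

import Mathlib

namespace RainbowConnection

variable {V : Type*} {α : Type*}

/-- A walk of the edge-coloured graph `(G, c)` is rainbow if distinct edges on it have
distinct colours. (It is only applied to paths, which do not repeat edges.) -/
def IsRainbow {G : SimpleGraph V} (c : G.edgeSet → α) {u v : V} (p : G.Walk u v) : Prop :=
  ∀ (e f : Sym2 V) (he : e ∈ p.edges) (hf : f ∈ p.edges),
    c ⟨e, p.edges_subset_edgeSet he⟩ = c ⟨f, p.edges_subset_edgeSet hf⟩ → e = f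

/-- A geodesic: a path of shortest possible length between its ends. -/
def IsGeodesic {G : SimpleGraph V} {u v : V} (p : G.Walk u v) : Prop :=
  p.IsPath ∧ p.length = G.dist u v

/-- Any two vertices are connected by a rainbow path. -/
def RainbowConnected (G : SimpleGraph V) (c : G.edgeSet → α) : Prop :=
  ∀ u v : V, ∃ p : G.Walk u v, p.IsPath ∧ IsRainbow c p

/-- Any two vertices are connected by a rainbow geodesic. -/
def StronglyRainbowConnected (G : SimpleGraph V) (c : G.edgeSet → α) : Prop :=
  ∀ u v : V, ∃ p : G.Walk u v, IsGeodesic p ∧ IsRainbow c p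

/-- An `r`-edge-list assignment: every edge gets a list of at least `r` natural numbers
(the lists may be infinite). -/
def IsEdgeListAssignment (G : SimpleGraph V) (r : ℕ) (L : G.edgeSet → Set ℕ) : Prop :=
  ∀ e, (r : ℕ∞) ≤ (L e).encard

/-- An `L`-edge-colouring: every edge gets a colour from its own list. -/
def IsListEdgeColouring (G : SimpleGraph V) (L : G.edgeSet → Set ℕ) (c : G.edgeSet → ℕ) : Prop :=
  ∀ e, c e ∈ L e

/-- The strong rainbow connection number `src(G)`. -/
noncomputable def src (G : SimpleGraph V) : ℕ :=
  sInf {r : ℕ | 1 ≤ r ∧ ∃ c : G.edgeSet → Fin r, StronglyRainbowConnected G c}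

/-- The list rainbow connection number `rc^ℓ(G)`. -/
noncomputable def rcList (G : SimpleGraph V) : ℕ :=
  sInf {r : ℕ | 1 ≤ r ∧ ∀ L : G.edgeSet → Set ℕ, IsEdgeListAssignment G r L →
    ∃ c : G.edgeSet → ℕ, IsListEdgeColouring G L c ∧ RainbowConnected G c}

/-- The list strong rainbow connection number `src^ℓ(G)`. -/
noncomputable def srcList (G : SimpleGraph V) : ℕ :=
  sInf {r : ℕ | 1 ≤ r ∧ ∀ L : G.edgeSet → Set ℕ, IsEdgeListAssignment G r L →
    ∃ c : G.edgeSet → ℕ, IsListEdgeColouring G L c ∧ StronglyRainbowConnected G c}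

/-- The example graph `H`, with 10 vertices and 12 edges: two hubs `0` and `1`, two pendent
vertices `6, 7` at the hub `0`, two pendent vertices `8, 9` at the hub `1`, and four common
neighbours `2, 3, 4, 5` of the two hubs. -/
def exampleH : SimpleGraph (Fin 10) :=
  SimpleGraph.fromEdgeSet (({s(0, 6), s(0, 7), s(1, 8), s(1, 9),
    s(1, 2), s(1, 3), s(1, 4), s(1, 5),
    s(0, 2), s(0, 3), s(0, 4), s(0, 5)} : Finset (Sym2 (Fin 10))) : Set (Sym2 (Fin 10)))

/-- The example graph `G`: the graph `H` with the edge between the two hubs added. -/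
def exampleG : SimpleGraph (Fin 10) :=
  exampleH ⊔ SimpleGraph.edge 0 1

end RainbowConnection

namespace RainbowConnection

/-! In `exampleG` the hub edge lies on the unique geodesic between pendent vertices at different
hubs, which forces the four pendent edges and the hub edge to have five distinct colours, so `src`
is at least 5. In `exampleH` such vertices are at distance 4 and have four geodesics to choose from,
one through each middle vertex, and lists of size 4 suffice.

For the upper bound, let `a i` and `b j` be the pendent colours at the hubs `0` and `1`, all
distinct, and let the middle vertex `w` receive a pair of colours from `P w` and `Q w` that avoids
the pendent colours at the respective hubs. Two demands remain: the four pairs must be distinct, so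
that middle vertices see each other, and each of the four pendent pairs `(i, j)` needs a middle
vertex completing a rainbow geodesic. A given `w` can serve every `(i, j)` but at most one
(`eq_of_not_completes`), and a careful choice of `a` makes one `w` serve all of them
(`exists_completes`). Hence middle vertices can be matched to pendent pairs. Finally
`exists_injective_mem_of_card_le` makes the colour pairs distinct without losing any that is in use.

Monotonicity of `rcList` holds because a rainbow path survives the addition of edges; a geodesic
need not. -/

theorem exists_injective_mem_of_card_le {ι β : Type*} [Fintype ι] [DecidableEq β]
    (S : ι → Finset β) (hS : ∀ i, Fintype.card ι ≤ (S i).card) (f : ι → β) (hf : ∀ i, f i ∈ S i) :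
    ∃ g : ι → β, Function.Injective g ∧ (∀ i, g i ∈ S i) ∧ Set.range f ⊆ Set.range g := by
  classical
  induction hk : Fintype.card ι - (Finset.univ.image f).card using Nat.strong_induction_on
    generalizing f with
  | _ k ih =>
    by_cases hinj : Function.Injective f
    · exact ⟨f, hinj, hf, subset_rfl⟩
    · obtain ⟨i, j, hij, hne⟩ : ∃ i j, f i = f j ∧ i ≠ j := by
        simpa [Function.Injective] using hinj
      have hlt : (Finset.univ.image f).card < Fintype.card ι := by
        refine lt_of_le_of_ne Finset.card_image_le fun h => hinj ?_
        have := Finset.card_image_iff.1 (h.trans Finset.card_univ.symm)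
        simpa using this
      -- Redirecting `i` to an unused value `s` loses nothing, since `j` still attains `f i`; the
      -- image grows by one.
      obtain ⟨s, hs, hs'⟩ := Finset.exists_mem_notMem_of_card_lt_card (hlt.trans_le (hS i))
      have hsub : Set.range f ⊆ Set.range (Function.update f i s) := by
        rintro _ ⟨l, rfl⟩
        by_cases hl : l = i
        · subst hl
          exact ⟨j, by rw [Function.update_of_ne hne.symm, hij]⟩
        · exact ⟨l, by rw [Function.update_of_ne hl]⟩
      have hcard : (Finset.univ.image f).card <
          (Finset.univ.image (Function.update f i s)).card := by
        refine Finset.card_lt_card ⟨?_, fun h => hs' (h ?_)⟩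
        · intro x hx
          have : x ∈ Set.range f := by simpa using hx
          simpa using hsub this
        · exact Finset.mem_image.2 ⟨i, Finset.mem_univ _, by simp⟩
      obtain ⟨g, h1, h2, h3⟩ := ih _ (by omega) (Function.update f i s) (by
        intro l
        by_cases hl : l = i
        · subst hl; simpa using hs
        · rw [Function.update_of_ne hl]; exact hf l) rfl
      exact ⟨g, h1, h2, hsub.trans h3⟩

/-! ### General facts on list colourings -/

section General

variable {V : Type*} {G H : SimpleGraph V}

theorem exists_finset_subset_of_isEdgeListAssignment {r : ℕ} {L : G.edgeSet → Set ℕ}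
    (hL : IsEdgeListAssignment G r L) :
    ∃ l : G.edgeSet → Finset ℕ, ∀ e, (l e).card = r ∧ (l e : Set ℕ) ⊆ L e := by
  have h : ∀ e, ∃ t : Finset ℕ, t.card = r ∧ (t : Set ℕ) ⊆ L e := by
    intro e
    obtain ⟨t, ht, hr⟩ := Set.exists_subset_encard_eq (hL e)
    have hfin : t.Finite := Set.finite_of_encard_eq_coe hr
    refine ⟨hfin.toFinset, ?_, by simpa using ht⟩
    rw [hfin.encard_eq_coe_toFinset_card] at hr
    exact_mod_cast hr
  choose l hl using h
  exact ⟨l, hl⟩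

/-- Long lists allow an injective colouring, for which every geodesic is rainbow. This keeps the
sets under `sInf` nonempty, so that their infima are attained. -/
theorem exists_strongly_listColouring [Finite V] (hG : G.Connected) :
    ∃ r : ℕ, 1 ≤ r ∧ ∀ L : G.edgeSet → Set ℕ, IsEdgeListAssignment G r L →
      ∃ c : G.edgeSet → ℕ, IsListEdgeColouring G L c ∧ StronglyRainbowConnected G c := by
  classical
  have := Fintype.ofFinite G.edgeSet
  -- The extra 1 ensures `1 ≤ r` even without edges.
  refine ⟨Fintype.card G.edgeSet + 1, by omega, fun L hL => ?_⟩
  obtain ⟨l, hl⟩ := exists_finset_subset_of_isEdgeListAssignment hL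
  have hne : ∀ e, ∃ x, x ∈ l e := fun e => Finset.card_pos.1 (by rw [(hl e).1]; omega)
  choose f hf using hne
  obtain ⟨c, hc, hcl, -⟩ := exists_injective_mem_of_card_le l
    (fun e => by rw [(hl e).1]; omega) f hf
  refine ⟨c, fun e => (hl e).2 (hcl e), fun u v => ?_⟩
  obtain ⟨p, hp, hlen⟩ := (hG u v).exists_path_of_dist
  exact ⟨p, ⟨hp, hlen⟩, fun e f he hf h => congrArg Subtype.val (hc h)⟩

theorem src_spec_of_srcList_spec {r : ℕ}
    (h : ∀ L : G.edgeSet → Set ℕ, IsEdgeListAssignment G r L →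
      ∃ c : G.edgeSet → ℕ, IsListEdgeColouring G L c ∧ StronglyRainbowConnected G c) :
    ∃ c : G.edgeSet → Fin r, StronglyRainbowConnected G c := by
  obtain ⟨c, hc, hs⟩ := h (fun _ => (Finset.range r : Set ℕ)) (fun e => by
    rw [Set.encard_coe_eq_coe_finsetCard, Finset.card_range])
  have hc' : ∀ e, c e < r := fun e => by simpa using hc e
  refine ⟨fun e => ⟨c e, hc' e⟩, fun u v => ?_⟩
  obtain ⟨p, hp, hr⟩ := hs u v
  exact ⟨p, hp, fun e f he hf h => hr e f he hf (by simpa using h)⟩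

theorem le_src [Finite V] (hG : G.Connected) {n : ℕ}
    (h : ∀ r (c : G.edgeSet → Fin r), StronglyRainbowConnected G c → n ≤ r) : n ≤ src G := by
  obtain ⟨r, hr, hL⟩ := exists_strongly_listColouring hG
  refine le_csInf ⟨r, hr, src_spec_of_srcList_spec hL⟩ ?_
  rintro s ⟨-, c, hc⟩
  exact h s c hc

theorem src_le_srcList [Finite V] (hG : G.Connected) : src G ≤ srcList G := by
  obtain ⟨h1, h2⟩ := Nat.sInf_mem (s := {r : ℕ | 1 ≤ r ∧ ∀ L : G.edgeSet → Set ℕ,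
    IsEdgeListAssignment G r L → ∃ c : G.edgeSet → ℕ,
      IsListEdgeColouring G L c ∧ StronglyRainbowConnected G c}) (exists_strongly_listColouring hG)
  exact Nat.sInf_le ⟨h1, src_spec_of_srcList_spec h2⟩

theorem rcList_anti [Finite V] (hH : H.Connected) (hle : H ≤ G) : rcList G ≤ rcList H := by
  classical
  have hne : {r : ℕ | 1 ≤ r ∧ ∀ L : H.edgeSet → Set ℕ, IsEdgeListAssignment H r L →
      ∃ c : H.edgeSet → ℕ, IsListEdgeColouring H L c ∧ RainbowConnected H c}.Nonempty := by
    obtain ⟨r, hr, h⟩ := exists_strongly_listColouring hH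
    refine ⟨r, hr, fun L hL => ?_⟩
    obtain ⟨c, hc, hs⟩ := h L hL
    refine ⟨c, hc, fun u v => ?_⟩
    obtain ⟨p, hp, hp'⟩ := hs u v
    exact ⟨p, hp.1, hp'⟩
  obtain ⟨h1, h2⟩ := Nat.sInf_mem hne
  refine Nat.sInf_le ⟨h1, fun L hL => ?_⟩
  have hsub : H.edgeSet ⊆ G.edgeSet := SimpleGraph.edgeSet_mono hle
  obtain ⟨c, hc, hr⟩ := h2 (fun e => L ⟨e, hsub e.2⟩) (fun e => hL _)
  have hLne : ∀ e, (L e).Nonempty := fun e => by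
    rw [← Set.one_le_encard_iff_nonempty]
    exact le_trans (by exact_mod_cast h1) (hL e)
  choose d hd using hLne
  refine ⟨fun e => if h : e.1 ∈ H.edgeSet then c ⟨e, h⟩ else d e, fun e => ?_, fun u v => ?_⟩
  · by_cases h : e.1 ∈ H.edgeSet
    · simpa [h] using hc ⟨e, h⟩
    · simpa [h] using hd e
  · obtain ⟨p, hp, hp'⟩ := hr u v
    refine ⟨p.mapLe hle, (SimpleGraph.Walk.isPath_mapLe hle).2 hp, fun e f he hf hef => ?_⟩
    rw [SimpleGraph.Walk.edges_mapLe_eq_edges] at he hf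
    refine hp' e f he hf ?_
    simpa [p.edges_subset_edgeSet he, p.edges_subset_edgeSet hf] using hef

theorem IsRainbow.length_le {α : Type*} [Fintype α] {c : G.edgeSet → α} {u v : V} {p : G.Walk u v}
    (hc : IsRainbow c p) (hp : p.IsPath) : p.length ≤ Fintype.card α := by
  have hnd : p.edges.attach.Nodup := List.nodup_attach.2 hp.isTrail.edges_nodup
  have h : (p.edges.attach.map fun e => c ⟨e.1, p.edges_subset_edgeSet e.2⟩).Nodup := by
    refine hnd.map_on ?_
    rintro ⟨e, he⟩ - ⟨f, hf⟩ - h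
    exact Subtype.ext (hc e f he hf h)
  simpa using h.length_le_card

theorem IsRainbow.reverse {α : Type*} {c : G.edgeSet → α} {u v : V} {p : G.Walk u v}
    (hc : IsRainbow c p) : IsRainbow c p.reverse := fun e f he hf h =>
  hc e f (by simpa using he) (by simpa using hf) h

/-- The vertices `u` and `v` are joined by a geodesic that is rainbow for the restriction of `k`
to the edges of `G`. -/
def HasRainbowGeodesic (G : SimpleGraph V) (k : Sym2 V → ℕ) (u v : V) : Prop :=
  ∃ p : G.Walk u v, IsGeodesic p ∧ IsRainbow (fun e : G.edgeSet => k e) p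

theorem HasRainbowGeodesic.symm {k : Sym2 V → ℕ} {u v : V} (h : HasRainbowGeodesic G k u v) :
    HasRainbowGeodesic G k v u := by
  obtain ⟨p, ⟨hp, hl⟩, hr⟩ := h
  exact ⟨p.reverse, ⟨hp.reverse, by rw [SimpleGraph.Walk.length_reverse, hl,
    SimpleGraph.dist_comm]⟩, hr.reverse⟩

theorem hasRainbowGeodesic_of_walk {k : Sym2 V → ℕ} {u v : V} (p : G.Walk u v)
    (hmin : ∀ q : G.Walk u v, p.length ≤ q.length) (hr : (p.edges.map k).Nodup) :
    HasRainbowGeodesic G k u v := by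
  have hl : p.length = G.dist u v := by
    obtain ⟨q, hq⟩ := p.reachable.exists_walk_length_eq_dist
    exact le_antisymm (hq ▸ hmin q) (SimpleGraph.dist_le p)
  exact ⟨p, ⟨p.isPath_of_length_eq_dist hl, hl⟩,
    fun e f he hf h => List.inj_on_of_nodup_map hr he hf h⟩

theorem hasRainbowGeodesic_refl (k : Sym2 V → ℕ) (u : V) : HasRainbowGeodesic G k u u :=
  hasRainbowGeodesic_of_walk .nil (by simp) (by simp)

/-- This and the next three bounds reduce minimality of a walk to adjacency conditions that `decide`
can check. -/
theorem one_le_length_of_ne {u v : V} (h : u ≠ v) (q : G.Walk u v) : 1 ≤ q.length := by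
  cases q with
  | nil => exact absurd rfl h
  | cons _ _ => simp

theorem two_le_length {u v : V} (h : u ≠ v) (h' : ¬G.Adj u v) (q : G.Walk u v) :
    2 ≤ q.length := by
  cases q with
  | nil => exact absurd rfl h
  | cons ha q =>
    have := one_le_length_of_ne (fun e => h' (by rwa [e] at ha)) q
    simp; omega

theorem three_le_length {u v : V} (h : u ≠ v) (h' : ¬G.Adj u v)
    (h'' : ∀ m, G.Adj u m → ¬G.Adj m v) (q : G.Walk u v) : 3 ≤ q.length := by
  cases q with
  | nil => exact absurd rfl h
  | cons ha q =>
    have := two_le_length (fun e => h' (by rwa [e] at ha)) (h'' _ ha) q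
    simp; omega

theorem four_le_length {u v : V} (h : u ≠ v) (h' : ¬G.Adj u v)
    (h'' : ∀ m, G.Adj u m → ¬G.Adj m v) (h''' : ∀ m, G.Adj u m → ∀ n, G.Adj m n → ¬G.Adj n v)
    (q : G.Walk u v) : 4 ≤ q.length := by
  cases q with
  | nil => exact absurd rfl h
  | cons ha q =>
    have := three_le_length (fun e => h' (by rwa [e] at ha)) (h'' _ ha) (h''' _ ha) q
    simp; omega

theorem hasRainbowGeodesic_of_adj (k : Sym2 V → ℕ) {u v : V} (h : G.Adj u v) :
    HasRainbowGeodesic G k u v :=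
  hasRainbowGeodesic_of_walk (.cons h .nil) (one_le_length_of_ne h.ne) (by simp)

theorem hasRainbowGeodesic_two {k : Sym2 V → ℕ} {u m v : V} (h1 : G.Adj u m) (h2 : G.Adj m v)
    (h : u ≠ v) (h' : ¬G.Adj u v) (hk : k s(u, m) ≠ k s(m, v)) : HasRainbowGeodesic G k u v :=
  hasRainbowGeodesic_of_walk (.cons h1 (.cons h2 .nil)) (two_le_length h h') (by simp [hk])

end General

/-! ### The combinatorial core of `srcList exampleH ≤ 4` -/

section Core

/-- The colours `x ∈ P`, `y ∈ Q` of the two edges at a common neighbour avoid all colours at the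
respective hub and complete a rainbow path between the pendent edges coloured `a i` and `b j`. -/
def Completes (P Q : Finset ℕ) (a b : Fin 2 → ℕ) (ij : Fin 2 × Fin 2) (xy : ℕ × ℕ) : Prop :=
  xy ∈ (P \ {a 0, a 1}) ×ˢ (Q \ {b 0, b 1}) ∧ xy.1 ≠ b ij.2 ∧ xy.2 ≠ a ij.1 ∧ xy.1 ≠ xy.2

variable {P Q : Finset ℕ} {a b : Fin 2 → ℕ}

/-- Removing three colours from each list leaves nonempty sets. If no choice completes, any element
of one equals any element of the other, so both are the same singleton `{z}`. -/
theorem exists_eq_of_not_completes (hP : P.card = 4) (hQ : Q.card = 4) {i j : Fin 2}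
    (h : ¬∃ xy, Completes P Q a b (i, j) xy) :
    ∃ z, P = {a 0, a 1, b j, z} ∧ Q = {b 0, b 1, a i, z} := by
  have key : ∀ (R : Finset ℕ) (p q s z : ℕ), R.card = 4 → R \ {p, q, s} ⊆ {z} →
      R = {p, q, s, z} := by
    intro R p q s z hR hz
    refine Finset.eq_of_subset_of_card_le (fun t ht => ?_) ?_
    · by_cases h' : t ∈ ({p, q, s} : Finset ℕ)
      · simp only [Finset.mem_insert, Finset.mem_singleton] at h' ⊢; tauto
      · have := hz (Finset.mem_sdiff.2 ⟨ht, h'⟩)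
        simp only [Finset.mem_insert, Finset.mem_singleton] at this ⊢; tauto
    · rw [hR]; exact Finset.card_le_four
  have hne : ∀ (R : Finset ℕ) (p q s : ℕ), R.card = 4 → (R \ {p, q, s}).Nonempty := by
    intro R p q s hR
    refine Finset.card_pos.1 ?_
    have h1 := Finset.le_card_sdiff {p, q, s} R
    have h2 : ({p, q, s} : Finset ℕ).card ≤ 3 := Finset.card_le_three
    omega
  have heq : ∀ x ∈ P \ {a 0, a 1, b j}, ∀ y ∈ Q \ {b 0, b 1, a i}, x = y := by
    intro x hx y hy
    by_contra hxy
    simp only [Finset.mem_sdiff, Finset.mem_insert, Finset.mem_singleton, not_or] at hx hy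
    refine h ⟨(x, y), ?_, hx.2.2.2, hy.2.2.2, hxy⟩
    simp [hx, hy]
  obtain ⟨x, hx⟩ := hne P (a 0) (a 1) (b j) hP
  obtain ⟨y, hy⟩ := hne Q (b 0) (b 1) (a i) hQ
  refine ⟨x, key P _ _ _ _ hP fun t ht => ?_, key Q _ _ _ _ hQ fun t ht => ?_⟩
  · rw [Finset.mem_singleton, heq t ht y hy, heq x hx y hy]
  · rw [Finset.mem_singleton, heq x hx t ht]

theorem ne_of_card_eq_four {p q r s : ℕ} (h : ({p, q, r, s} : Finset ℕ).card = 4) :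
    p ≠ q ∧ p ≠ r ∧ p ≠ s ∧ q ≠ r ∧ q ≠ s ∧ r ≠ s := by
  rw [Finset.card_insert_eq_ite, Finset.card_insert_eq_ite, Finset.card_insert_eq_ite] at h
  split_ifs at h <;> simp_all

/-- On failure, `z` differs from every `a` and `b` because the lists have four elements. So `P`
contains only one of the `b` colours and `Q` only one of the `a` colours, and these determine the
failing pair. -/
theorem eq_of_not_completes (hP : P.card = 4) (hQ : Q.card = 4) (hab : ∀ i j, a i ≠ b j)
    {u v : Fin 2 × Fin 2}
    (hu : ¬∃ xy, Completes P Q a b u xy) (hv : ¬∃ xy, Completes P Q a b v xy) : u = v := by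
  obtain ⟨i, j⟩ := u
  obtain ⟨i', j'⟩ := v
  obtain ⟨z, h1, h2⟩ := exists_eq_of_not_completes hP hQ hu
  obtain ⟨z', h3, h4⟩ := exists_eq_of_not_completes hP hQ hv
  obtain ⟨-, -, n1, -, n2, n3⟩ := ne_of_card_eq_four (h1 ▸ hP)
  obtain ⟨-, -, m1, -, m2, m3⟩ := ne_of_card_eq_four (h2 ▸ hQ)
  have hj : b j' ∈ P := by rw [h3]; simp
  have hi : a i' ∈ Q := by rw [h4]; simp
  have hbz : ∀ j, b j ≠ z := by intro j; fin_cases j <;> assumption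
  have haz : ∀ i, a i ≠ z := by intro i; fin_cases i <;> assumption
  have hj' : b j' = b j := by
    rw [h1] at hj
    simpa [hbz, (hab _ _).symm] using hj
  have hi' : a i' = a i := by
    rw [h2] at hi
    simpa [haz, hab] using hi
  obtain ⟨ha, -⟩ := ne_of_card_eq_four (h1 ▸ hP)
  obtain ⟨hb, -⟩ := ne_of_card_eq_four (h2 ▸ hQ)
  have inj : ∀ (f : Fin 2 → ℕ), f 0 ≠ f 1 → ∀ k l, f k = f l → l = k := by
    intro f hf k l h
    fin_cases k <;> fin_cases l <;> simp_all
  rw [inj a ha _ _ hi', inj b hb _ _ hj']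

/-- Failure at `(i, j)` would make `P \ Q` consist of the colour `a` of the other index alone, so
`p` would be that colour. -/
theorem exists_completes (hP : P.card = 4) (hQ : Q.card = 4) (hab : ∀ i j, a i ≠ b j)
    {p : ℕ} (hp : (P \ Q).Nonempty → p ∈ P \ Q) (ha0 : a 0 ≠ p) (ha1 : a 1 ≠ p)
    (u : Fin 2 × Fin 2) : ∃ xy, Completes P Q a b u xy := by
  by_contra hu
  obtain ⟨i, j⟩ := u
  obtain ⟨z, h1, h2⟩ := exists_eq_of_not_completes hP hQ hu
  obtain ⟨ha, -, n1, -, n2, -⟩ := ne_of_card_eq_four (h1 ▸ hP)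
  have hne : (P \ Q).Nonempty := by
    have hi : ∃ k, a k ≠ a i ∧ a k ≠ z ∧ a k ∈ P := by
      fin_cases i
      · exact ⟨1, ha.symm, n2, by rw [h1]; simp⟩
      · exact ⟨0, ha, n1, by rw [h1]; simp⟩
    obtain ⟨k, hk, hz, hkP⟩ := hi
    refine ⟨a k, Finset.mem_sdiff.2 ⟨hkP, ?_⟩⟩
    rw [h2]
    simp [hk, hz, hab]
  have hpm := hp hne
  rw [Finset.mem_sdiff, h1, h2] at hpm
  simp only [Finset.mem_insert, Finset.mem_singleton, ha0.symm, ha1.symm, false_or, not_or] at hpm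
  obtain ⟨hl | hl, hb0, hb1, -, hz⟩ := hpm
  · fin_cases j
    · exact hb0 hl
    · exact hb1 hl
  · exact hz hl

theorem exists_surjective_of_subsingleton_compl {κ : Type*} [Fintype κ]
    (hκ : Fintype.card κ = 4) (R : Fin 4 → κ → Prop) (h0 : ∀ u, R 0 u)
    (h : ∀ w u v, ¬R w u → ¬R w v → u = v) :
    ∃ σ : Fin 4 → κ, Function.Surjective σ ∧ ∀ w, R w (σ w) := by
  classical
  -- Each `w` admits at least three elements, so 1, 2, 3 can be served greedily; 0 takes whatever is
  -- left.
  have key : ∀ w (T : Finset κ), T.card ≤ 2 → ∃ u, R w u ∧ u ∉ T := by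
    intro w T hT
    have h1 : (Finset.univ.filter fun u => ¬R w u).card ≤ 1 := by
      rw [Finset.card_le_one]
      intro u hu v hv
      exact h w u v (by simpa using hu) (by simpa using hv)
    have h2 := Finset.card_filter_add_card_filter_not (s := (Finset.univ : Finset κ)) (R w)
    rw [Finset.card_univ, hκ] at h2
    obtain ⟨u, hu, hu'⟩ := Finset.exists_mem_notMem_of_card_lt_card
      (show T.card < (Finset.univ.filter (R w)).card by omega)
    exact ⟨u, by simpa using hu, hu'⟩
  obtain ⟨u₁, h1, -⟩ := key 1 ∅ (by simp)
  obtain ⟨u₂, h2, h2'⟩ := key 2 {u₁} (by simp)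
  obtain ⟨u₃, h3, h3'⟩ := key 3 {u₁, u₂} Finset.card_le_two
  obtain ⟨u₀, -, h4'⟩ := Finset.exists_mem_notMem_of_card_lt_card
    (show ({u₁, u₂, u₃} : Finset κ).card < (Finset.univ : Finset κ).card from
      Finset.card_le_three.trans_lt (by rw [Finset.card_univ, hκ]; norm_num))
  simp only [Finset.mem_insert, Finset.mem_singleton, not_or] at h2' h3' h4'
  refine ⟨![u₀, u₁, u₂, u₃], ?_, ?_⟩
  · refine ((Fintype.bijective_iff_injective_and_card _).2 ⟨?_, by simp [hκ]⟩).2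
    intro k l hkl
    fin_cases k <;> fin_cases l <;> simp_all
  · intro w
    fin_cases w
    · exact h0 _
    · exact h1
    · exact h2
    · exact h3

theorem exists_colours (A B : Fin 2 → Finset ℕ) (P Q : Fin 4 → Finset ℕ)
    (hA : ∀ i, (A i).card = 4) (hB : ∀ i, (B i).card = 4)
    (hP : ∀ w, (P w).card = 4) (hQ : ∀ w, (Q w).card = 4) :
    ∃ (a b : Fin 2 → ℕ) (g : Fin 4 → ℕ × ℕ), (∀ i, a i ∈ A i) ∧ (∀ i, b i ∈ B i) ∧
      a 0 ≠ a 1 ∧ b 0 ≠ b 1 ∧ (∀ i j, a i ≠ b j) ∧ Function.Injective g ∧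
      (∀ w, g w ∈ (P w \ {a 0, a 1}) ×ˢ (Q w \ {b 0, b 1})) ∧
      ∀ u : Fin 2 × Fin 2, ∃ w, (g w).1 ≠ b u.2 ∧ (g w).2 ≠ a u.1 ∧ (g w).1 ≠ (g w).2 := by
  -- The colour `p` is kept off both pendent edges at hub `0`, so that middle vertex 0 can serve
  -- every pendent pair.
  obtain ⟨p, hp⟩ : ∃ p, (P 0 \ Q 0).Nonempty → p ∈ P 0 \ Q 0 := by
    by_cases h : (P 0 \ Q 0).Nonempty
    · exact ⟨h.choose, fun _ => h.choose_spec⟩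
    · exact ⟨0, fun h' => absurd h' h⟩
  have pick : ∀ S : Finset ℕ, S.card = 4 → ∀ T : Finset ℕ, T.card ≤ 3 → ∃ x ∈ S, x ∉ T :=
    fun S hS T hT => Finset.exists_mem_notMem_of_card_lt_card (by omega)
  obtain ⟨a₀, ha₀, ha₀'⟩ := pick _ (hA 0) {p} (by simp)
  obtain ⟨a₁, ha₁, ha₁'⟩ := pick _ (hA 1) {p, a₀} (Finset.card_le_two.trans (by norm_num))
  obtain ⟨b₀, hb₀, hb₀'⟩ := pick _ (hB 0) {a₀, a₁} (Finset.card_le_two.trans (by norm_num))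
  obtain ⟨b₁, hb₁, hb₁'⟩ := pick _ (hB 1) {a₀, a₁, b₀} Finset.card_le_three
  simp only [Finset.mem_insert, Finset.mem_singleton, not_or] at ha₀' ha₁' hb₀' hb₁'
  obtain ⟨a, rfl, rfl⟩ : ∃ a : Fin 2 → ℕ, a 0 = a₀ ∧ a 1 = a₁ := ⟨![a₀, a₁], rfl, rfl⟩
  obtain ⟨b, rfl, rfl⟩ : ∃ b : Fin 2 → ℕ, b 0 = b₀ ∧ b 1 = b₁ := ⟨![b₀, b₁], rfl, rfl⟩
  have hab : ∀ i j, a i ≠ b j := by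
    intro i j h
    fin_cases i <;> fin_cases j <;> simp_all
  obtain ⟨σ, hσ, hR⟩ := exists_surjective_of_subsingleton_compl (κ := Fin 2 × Fin 2) (by simp)
    (fun w u => ∃ xy, Completes (P w) (Q w) a b u xy)
    (exists_completes (hP 0) (hQ 0) hab hp ha₀' ha₁'.1)
    (fun w u v hu hv => eq_of_not_completes (hP w) (hQ w) hab hu hv)
  choose f hf using hR
  have two : ∀ S : Finset ℕ, S.card = 4 → ∀ x y, 2 ≤ (S \ {x, y}).card := by
    intro S hS x y
    have h1 := Finset.le_card_sdiff {x, y} S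
    have h2 : ({x, y} : Finset ℕ).card ≤ 2 := Finset.card_le_two
    omega
  obtain ⟨g, hg, hgm, hfg⟩ := exists_injective_mem_of_card_le
    (fun w => (P w \ {a 0, a 1}) ×ˢ (Q w \ {b 0, b 1})) (fun w => by
      rw [Finset.card_product, Fintype.card_fin]
      exact Nat.mul_le_mul (two _ (hP w) _ _) (two _ (hQ w) _ _)) f (fun w => (hf w).1)
  refine ⟨a, b, g, ?_, ?_, Ne.symm ha₁'.2, Ne.symm hb₁'.2.2, hab, hg, hgm, fun u => ?_⟩
  · intro i; fin_cases i <;> assumption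
  · intro i; fin_cases i <;> assumption
  · obtain ⟨w, rfl⟩ := hσ u
    -- The pair `f w` may now sit at another middle vertex; the completing conditions depend only on
    -- the pair.
    obtain ⟨w', hw'⟩ := hfg ⟨w, rfl⟩
    exact ⟨w', by rw [hw']; exact (hf w).2⟩

end Core

/-! ### The example graphs -/

section Example

instance : DecidableRel exampleH.Adj := fun x y =>
  decidable_of_iff (s(x, y) ∈ ({s(0, 6), s(0, 7), s(1, 8), s(1, 9),
    s(1, 2), s(1, 3), s(1, 4), s(1, 5),
    s(0, 2), s(0, 3), s(0, 4), s(0, 5)} : Finset (Sym2 (Fin 10))) ∧ x ≠ y)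
    (by rw [exampleH, SimpleGraph.fromEdgeSet_adj, Finset.mem_coe])

theorem exampleG_adj (x y : Fin 10) :
    exampleG.Adj x y ↔ exampleH.Adj x y ∨ s(x, y) = s(0, 1) := by
  rw [exampleG, SimpleGraph.sup_adj, SimpleGraph.edge_adj]
  revert x y
  decide

instance : DecidableRel exampleG.Adj := fun x y => decidable_of_iff _ (exampleG_adj x y).symm

theorem exampleH_le_exampleG : exampleH ≤ exampleG := le_sup_left

theorem exampleH_connected : exampleH.Connected := by
  rw [SimpleGraph.connected_iff_exists_forall_reachable]
  have h2 : ∀ x : Fin 10, exampleH.Adj 0 x → exampleH.Reachable 0 x := fun x h => h.reachable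
  have h1 : exampleH.Reachable 0 1 :=
    (h2 2 (by decide)).trans (SimpleGraph.Adj.reachable (by decide))
  have h3 : ∀ x : Fin 10, x = 0 ∨ x = 1 ∨ exampleH.Adj 0 x ∨ exampleH.Adj 1 x := by decide
  refine ⟨0, fun x => ?_⟩
  obtain rfl | rfl | h | h := h3 x
  · exact .refl _
  · exact h1
  · exact h2 x h
  · exact h1.trans h.reachable

theorem exampleG_connected : exampleG.Connected := exampleH_connected.mono exampleH_le_exampleG

theorem ncard_edgeSet_exampleH : exampleH.edgeSet.ncard = 12 := by
  have h : exampleH.edgeSet = (({s(0, 6), s(0, 7), s(1, 8), s(1, 9),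
      s(1, 2), s(1, 3), s(1, 4), s(1, 5),
      s(0, 2), s(0, 3), s(0, 4), s(0, 5)} : Finset (Sym2 (Fin 10))) : Set (Sym2 (Fin 10))) := by
    rw [exampleH, SimpleGraph.edgeSet_fromEdgeSet, sdiff_eq_left, Set.disjoint_left]
    intro e he
    revert e
    simp only [Finset.mem_coe]
    simp
  rw [h, Set.ncard_coe_finset]
  decide

theorem edgeSet_exampleG : exampleG.edgeSet = insert s(0, 1) exampleH.edgeSet := by
  ext e
  induction e with
  | h x y =>
    rw [Set.mem_insert_iff, SimpleGraph.mem_edgeSet, SimpleGraph.mem_edgeSet, exampleG_adj, or_comm]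

/-! ### Bounds for the graph `exampleH`. -/

theorem four_le_src_exampleH : 4 ≤ src exampleH := by
  refine le_src exampleH_connected fun r c hc => ?_
  obtain ⟨p, hp, hr⟩ := hc 6 8
  have h1 := hr.length_le hp.1
  have h2 : 4 ≤ p.length :=
    four_le_length (by decide) (by decide) (by decide) (by decide) p
  rw [Fintype.card_fin] at h1
  exact h2.trans h1

/-- The stars at `0` and `1` share only `s(0, 1)`, hence the restriction `v ≠ 0`. -/
theorem exists_colouring_of_stars (x y : Fin 10 → ℕ) :
    ∃ k : Sym2 (Fin 10) → ℕ, (∀ v, k s(0, v) = x v) ∧ ∀ v, v ≠ 0 → k s(1, v) = y v := by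
  classical
  refine ⟨fun e => if h : ∃ v, e = s(0, v) then x h.choose else
    if h : ∃ v, e = s(1, v) then y h.choose else 0, fun v => ?_, fun v hv => ?_⟩
  · have h : ∃ v', s(0, v) = s(0, v') := ⟨v, rfl⟩
    simp only [dif_pos h]
    rw [← Sym2.congr_right.1 h.choose_spec]
  · have h : ∃ v', s(1, v) = s(1, v') := ⟨v, rfl⟩
    have h' : ¬∃ v', s(1, v) = s(0, v') := by
      rintro ⟨v', hv'⟩
      rw [Sym2.eq_iff] at hv'
      rcases hv' with hv' | hv'
      · exact absurd hv'.1 (by decide)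
      · exact hv hv'.2
    simp only [dif_neg h', dif_pos h]
    rw [← Sym2.congr_right.1 h.choose_spec]

/-- The pendent vertices at the hub `0`. -/
def pendentZero : Fin 2 → Fin 10 := ![6, 7]

/-- The pendent vertices at the hub `1`. -/
def pendentOne : Fin 2 → Fin 10 := ![8, 9]

/-- The common neighbours of the two hubs. -/
def middle : Fin 4 → Fin 10 := ![2, 3, 4, 5]

/-- Two middle vertices have a geodesic through each hub, so it is enough that one of the two is
rainbow. The geodesics from a hub to the other side are parts of those given by `hcov`. -/
theorem hasRainbowGeodesic_exampleH {k : Sym2 (Fin 10) → ℕ}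
    (ha : k s(0, 6) ≠ k s(0, 7)) (hb : k s(1, 8) ≠ k s(1, 9))
    (hab : ∀ i j, k s(0, pendentZero i) ≠ k s(1, pendentOne j))
    (haw : ∀ i w, k s(0, pendentZero i) ≠ k s(0, middle w))
    (hbw : ∀ j w, k s(1, pendentOne j) ≠ k s(1, middle w))
    (hww : ∀ w w', k s(0, middle w) = k s(0, middle w') → k s(1, middle w) = k s(1, middle w') →
      w = w')
    (hcov : ∀ i j, ∃ w, k s(0, middle w) ≠ k s(1, pendentOne j) ∧
      k s(1, middle w) ≠ k s(0, pendentZero i) ∧ k s(0, middle w) ≠ k s(1, middle w))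
    (u v : Fin 10) : HasRainbowGeodesic exampleH k u v := by
  have a0 : ∀ i, exampleH.Adj (pendentZero i) 0 := by decide
  have b1 : ∀ i, exampleH.Adj (pendentOne i) 1 := by decide
  have w0 : ∀ w, exampleH.Adj (middle w) 0 := by decide
  have w1 : ∀ w, exampleH.Adj (middle w) 1 := by decide
  have aa : HasRainbowGeodesic exampleH k 6 7 :=
    hasRainbowGeodesic_two (m := 0) (a0 0) (a0 1).symm (by decide) (by decide)
      (by rw [Sym2.eq_swap]; exact ha)
  have bb : HasRainbowGeodesic exampleH k 8 9 :=
    hasRainbowGeodesic_two (m := 1) (b1 0) (b1 1).symm (by decide) (by decide)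
      (by rw [Sym2.eq_swap]; exact hb)
  have aw : ∀ i w, HasRainbowGeodesic exampleH k (pendentZero i) (middle w) := fun i w =>
    hasRainbowGeodesic_two (a0 i) (w0 w).symm (by revert i w; decide) (by revert i w; decide)
      (by rw [Sym2.eq_swap]; exact haw i w)
  have bw : ∀ i w, HasRainbowGeodesic exampleH k (pendentOne i) (middle w) := fun i w =>
    hasRainbowGeodesic_two (b1 i) (w1 w).symm (by revert i w; decide) (by revert i w; decide)
      (by rw [Sym2.eq_swap]; exact hbw i w)
  have ww : ∀ w w', HasRainbowGeodesic exampleH k (middle w) (middle w') := by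
    intro w w'
    by_cases hw : w = w'
    · subst hw; exact hasRainbowGeodesic_refl _ _
    have hne : middle w ≠ middle w' := by revert w w'; decide
    have hna : ¬exampleH.Adj (middle w) (middle w') := by revert w w'; decide
    by_cases h : k s(0, middle w) = k s(0, middle w')
    · exact hasRainbowGeodesic_two (w1 w) (w1 w').symm hne hna
        (by rw [Sym2.eq_swap]; exact fun h' => hw (hww w w' h h'))
    · exact hasRainbowGeodesic_two (w0 w) (w0 w').symm hne hna (by rw [Sym2.eq_swap]; exact h)
  have ab4 : ∀ i j, ∀ q : exampleH.Walk (pendentZero i) (pendentOne j), 4 ≤ q.length := fun i j =>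
    four_le_length (by revert i j; decide) (by revert i j; decide) (by revert i j; decide)
      (by revert i j; decide)
  have a13 : ∀ i, ∀ q : exampleH.Walk (pendentZero i) 1, 3 ≤ q.length := fun i =>
    three_le_length (by revert i; decide) (by revert i; decide) (by revert i; decide)
  have b03 : ∀ j, ∀ q : exampleH.Walk (pendentOne j) 0, 3 ≤ q.length := fun j =>
    three_le_length (by revert j; decide) (by revert j; decide) (by revert j; decide)
  have ab : ∀ i j, HasRainbowGeodesic exampleH k (pendentZero i) (pendentOne j) := by
    intro i j
    obtain ⟨w, h1, h2, h3⟩ := hcov i j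
    refine hasRainbowGeodesic_of_walk
      (.cons (a0 i) (.cons (w0 w).symm (.cons (w1 w) (.cons (b1 j).symm .nil))))
      (ab4 i j) ?_
    simp [Sym2.eq_swap (a := pendentZero i), Sym2.eq_swap (a := middle w), haw, hab, h1, h2.symm,
      h3, (hbw j w).symm]
  have a1 : ∀ i, HasRainbowGeodesic exampleH k (pendentZero i) 1 := by
    intro i
    obtain ⟨w, h1, h2, h3⟩ := hcov i 0
    refine hasRainbowGeodesic_of_walk (.cons (a0 i) (.cons (w0 w).symm (.cons (w1 w) .nil)))
      (a13 i) ?_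
    simp [Sym2.eq_swap (a := pendentZero i), Sym2.eq_swap (a := middle w), haw, h2.symm, h3]
  have b0 : ∀ j, HasRainbowGeodesic exampleH k (pendentOne j) 0 := by
    intro j
    obtain ⟨w, h1, h2, h3⟩ := hcov 0 j
    refine hasRainbowGeodesic_of_walk (.cons (b1 j) (.cons (w1 w).symm (.cons (w0 w) .nil)))
      (b03 j) ?_
    simp [Sym2.eq_swap (a := pendentOne j), Sym2.eq_swap (a := middle w), hbw, h1.symm, h3.symm]
  have zo : HasRainbowGeodesic exampleH k 0 1 := by
    obtain ⟨w, -, -, h3⟩ := hcov 0 0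
    exact hasRainbowGeodesic_two (w0 w).symm (w1 w) (by decide) (by decide)
      (by rw [Sym2.eq_swap (a := middle w)]; exact h3)
  have cases : ∀ x : Fin 10, x = 0 ∨ x = 1 ∨ (∃ i, x = pendentZero i) ∨ (∃ i, x = pendentOne i) ∨
      ∃ w, x = middle w := by decide
  have aa' : ∀ i i', HasRainbowGeodesic exampleH k (pendentZero i) (pendentZero i') := by
    intro i i'
    fin_cases i <;> fin_cases i'
    exacts [hasRainbowGeodesic_refl _ _, aa, aa.symm, hasRainbowGeodesic_refl _ _]
  have bb' : ∀ i i', HasRainbowGeodesic exampleH k (pendentOne i) (pendentOne i') := by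
    intro i i'
    fin_cases i <;> fin_cases i'
    exacts [hasRainbowGeodesic_refl _ _, bb, bb.symm, hasRainbowGeodesic_refl _ _]
  have adj : ∀ {x y}, exampleH.Adj x y → HasRainbowGeodesic exampleH k x y :=
    fun h => hasRainbowGeodesic_of_adj k h
  obtain rfl | rfl | ⟨i, rfl⟩ | ⟨i, rfl⟩ | ⟨w, rfl⟩ := cases u <;>
    obtain rfl | rfl | ⟨i', rfl⟩ | ⟨i', rfl⟩ | ⟨w', rfl⟩ := cases v
  exacts [hasRainbowGeodesic_refl _ _, zo, (adj (a0 _)).symm, (b0 _).symm, (adj (w0 _)).symm,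
    zo.symm, hasRainbowGeodesic_refl _ _, (a1 _).symm, (adj (b1 _)).symm, (adj (w1 _)).symm,
    adj (a0 _), a1 _, aa' _ _, ab _ _, aw _ _,
    b0 _, adj (b1 _), (ab _ _).symm, bb' _ _, bw _ _,
    adj (w0 _), adj (w1 _), (aw _ _).symm, (bw _ _).symm, ww _ _]

theorem srcList_exampleH_le_four : srcList exampleH ≤ 4 := by
  classical
  refine Nat.sInf_le ⟨by norm_num, fun L hL => ?_⟩
  obtain ⟨l, hl⟩ := exists_finset_subset_of_isEdgeListAssignment hL
  -- The value off the edge set is arbitrary of size 4, so that `ht` holds without membership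
  -- proofs.
  let t : Sym2 (Fin 10) → Finset ℕ :=
    fun e => if h : e ∈ exampleH.edgeSet then l ⟨e, h⟩ else Finset.range 4
  have ht : ∀ e, (t e).card = 4 := by
    intro e
    by_cases h : e ∈ exampleH.edgeSet
    · simp [t, h, (hl ⟨e, h⟩).1]
    · simp [t, h]
  obtain ⟨a, b, g, haA, hbB, ha, hb, hab, hg, hgm, hcov⟩ := exists_colours
    (fun i => t s(0, pendentZero i)) (fun i => t s(1, pendentOne i))
    (fun w => t s(0, middle w)) (fun w => t s(1, middle w))
    (fun _ => ht _) (fun _ => ht _) (fun _ => ht _) (fun _ => ht _)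
  obtain ⟨k, hk0, hk1⟩ := exists_colouring_of_stars
    ![0, 0, (g 0).1, (g 1).1, (g 2).1, (g 3).1, a 0, a 1, 0, 0]
    ![0, 0, (g 0).2, (g 1).2, (g 2).2, (g 3).2, 0, 0, b 0, b 1]
  have ka : ∀ i, k s(0, pendentZero i) = a i := by
    intro i; rw [hk0]; fin_cases i <;> rfl
  have kb : ∀ i, k s(1, pendentOne i) = b i := by
    intro i; rw [hk1 _ (by revert i; decide)]; fin_cases i <;> rfl
  have k0 : ∀ w, k s(0, middle w) = (g w).1 := by
    intro i; rw [hk0]; fin_cases i <;> rfl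
  have k1 : ∀ w, k s(1, middle w) = (g w).2 := by
    intro i; rw [hk1 _ (by revert i; decide)]; fin_cases i <;> rfl
  simp only [Finset.mem_product, Finset.mem_sdiff, Finset.mem_insert, Finset.mem_singleton,
    not_or] at hgm
  refine ⟨fun e => k e, ?_, hasRainbowGeodesic_exampleH ?_ ?_ ?_ ?_ ?_ ?_ ?_⟩
  · have hmem : ∀ e ∈ exampleH.edgeSet, k e ∈ t e := by
      have cases : ∀ x y, exampleH.Adj x y → (∃ i, s(x, y) = s(0, pendentZero i)) ∨
          (∃ i, s(x, y) = s(1, pendentOne i)) ∨ (∃ w, s(x, y) = s(0, middle w)) ∨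
          ∃ w, s(x, y) = s(1, middle w) := by decide
      intro e he
      induction e with
      | h x y =>
        obtain ⟨i, h⟩ | ⟨i, h⟩ | ⟨w, h⟩ | ⟨w, h⟩ := cases x y he <;> rw [h]
        · rw [ka]; exact haA i
        · rw [kb]; exact hbB i
        · rw [k0]; exact (hgm w).1.1
        · rw [k1]; exact (hgm w).2.1
    intro e
    have h := hmem e e.2
    simp only [t, dif_pos e.2] at h
    exact (hl e).2 h
  · exact fun h => ha (by rw [← ka 0, ← ka 1]; exact h)
  · exact fun h => hb (by rw [← kb 0, ← kb 1]; exact h)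
  · intro i j; rw [ka, kb]; exact hab i j
  · intro i w; rw [ka, k0]
    obtain ⟨⟨-, h1, h2⟩, -⟩ := hgm w
    fin_cases i
    exacts [Ne.symm h1, Ne.symm h2]
  · intro i w; rw [kb, k1]
    obtain ⟨-, -, h1, h2⟩ := hgm w
    fin_cases i
    exacts [Ne.symm h1, Ne.symm h2]
  · intro w w' h h'
    rw [k0, k0] at h
    rw [k1, k1] at h'
    exact hg (Prod.ext h h')
  · intro i j
    obtain ⟨w, hw⟩ := hcov (i, j)
    exact ⟨w, by rw [k0, k1, ka, kb]; exact hw⟩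

/-! ### Unique geodesics and the lower bound for `exampleG`. -/

theorem edges_eq_of_isGeodesic_two {V : Type*} {G : SimpleGraph V} {u v m : V}
    (hne : u ≠ v) (hna : ¬G.Adj u v) (hm : G.Adj u m) (hmv : G.Adj m v)
    (hu : ∀ n, G.Adj u n → G.Adj n v → n = m)
    {p : G.Walk u v} (hp : IsGeodesic p) : p.edges = [s(u, m), s(m, v)] := by
  have hl : p.length ≤ 2 := hp.2 ▸ SimpleGraph.dist_le (.cons hm (.cons hmv .nil))
  match p, hl with
  | .nil, _ => exact absurd rfl hne
  | .cons h .nil, _ => exact absurd h hna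
  | .cons h (.cons h' .nil), _ =>
    obtain rfl := hu _ h h'
    rfl
  | .cons _ (.cons _ (.cons _ q)), hl =>
    simp only [SimpleGraph.Walk.length_cons] at hl
    omega

theorem edges_eq_of_isGeodesic_three {V : Type*} {G : SimpleGraph V} {u v m n : V}
    (hne : u ≠ v) (hna : ¬G.Adj u v) (hna' : ¬G.Adj m v)
    (hm : G.Adj u m) (hmn : G.Adj m n) (hnv : G.Adj n v)
    (hu : ∀ x, G.Adj u x → x = m) (hv : ∀ x, G.Adj x v → x = n)
    {p : G.Walk u v} (hp : IsGeodesic p) : p.edges = [s(u, m), s(m, n), s(n, v)] := by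
  have hl : p.length ≤ 3 := hp.2 ▸ SimpleGraph.dist_le (.cons hm (.cons hmn (.cons hnv .nil)))
  match p, hl with
  | .nil, _ => exact absurd rfl hne
  | .cons h .nil, _ => exact absurd h hna
  | .cons h (.cons h' .nil), _ => exact absurd (hu _ h ▸ h') hna'
  | .cons h (.cons _ (.cons h' .nil)), _ =>
    obtain rfl := hu _ h
    obtain rfl := hv _ h'
    rfl
  | .cons _ (.cons _ (.cons _ (.cons _ q))), hl =>
    simp only [SimpleGraph.Walk.length_cons] at hl
    omega

/-- The four pendent edges and the edge between the hubs. -/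
def hubPendentEdges : Fin 5 → Sym2 (Fin 10) := ![s(0, 6), s(0, 7), s(0, 1), s(1, 8), s(1, 9)]

theorem hubPendentEdges_mem : ∀ x, hubPendentEdges x ∈ exampleG.edgeSet := by decide

theorem five_le_src_exampleG : 5 ≤ src exampleG := by
  refine le_src exampleG_connected fun r c hc => ?_
  have key : ∀ {u v : Fin 10} {l : List (Sym2 (Fin 10))},
      (∀ p : exampleG.Walk u v, IsGeodesic p → p.edges = l) →
      ∀ e f : exampleG.edgeSet, e.1 ∈ l → f.1 ∈ l → c e = c f → e = f := by
    intro u v l hl e f he hf h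
    obtain ⟨p, hp, hr⟩ := hc u v
    have hpl := hl p hp
    exact Subtype.ext (hr e f (hpl ▸ he) (hpl ▸ hf) h)
  have aa := key (fun p : exampleG.Walk 6 7 => edges_eq_of_isGeodesic_two (m := 0)
    (by decide) (by decide) (by decide) (by decide) (by decide))
  have bb := key (fun p : exampleG.Walk 8 9 => edges_eq_of_isGeodesic_two (m := 1)
    (by decide) (by decide) (by decide) (by decide) (by decide))
  have ab : ∀ i j, _ := fun i j =>
    key (u := pendentZero i) (v := pendentOne j) (fun _ =>
      edges_eq_of_isGeodesic_three (m := 0) (n := 1)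
        (by decide +revert) (by decide +revert) (by decide +revert)
        (by decide +revert) (by decide) (by decide +revert)
        (by decide +revert) (by decide +revert))
  have hinj : Function.Injective fun x => c ⟨hubPendentEdges x, hubPendentEdges_mem x⟩ := by
    intro x y h
    have hxy : hubPendentEdges x = hubPendentEdges y := by
      -- Any two of the five edges lie on a common unique geodesic, hence have different colours if
      -- distinct.
      have cover : ∀ x y, (hubPendentEdges x ∈ [s(6, 0), s(0, 7)] ∧ hubPendentEdges y ∈ [s(6, 0), s(0, 7)]) ∨
          (hubPendentEdges x ∈ [s(8, 1), s(1, 9)] ∧ hubPendentEdges y ∈ [s(8, 1), s(1, 9)]) ∨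
          ∃ i j, hubPendentEdges x ∈ [s(pendentZero i, 0), s(0, 1), s(1, pendentOne j)] ∧
            hubPendentEdges y ∈ [s(pendentZero i, 0), s(0, 1), s(1, pendentOne j)] := by decide
      obtain ⟨hx, hy⟩ | ⟨hx, hy⟩ | ⟨i, j, hx, hy⟩ := cover x y
      · exact congrArg Subtype.val (aa _ _ hx hy h)
      · exact congrArg Subtype.val (bb _ _ hx hy h)
      · exact congrArg Subtype.val (ab i j _ _ hx hy h)
    have inj : ∀ x y, hubPendentEdges x = hubPendentEdges y → x = y := by decide
    exact inj x y hxy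
  simpa using Fintype.card_le_of_injective _ hinj

end Example

end RainbowConnection

theorem mainTheorem11 :
    -- strong rainbow list numbers can increase when edges are added
    (∃ (V : Type) (_ : Finite V) (G H : SimpleGraph V),
      G.Connected ∧ H.Connected ∧ H ≤ G ∧
        RainbowConnection.srcList H < RainbowConnection.srcList G) ∧
    -- the specific example
    (RainbowConnection.exampleH.Connected ∧ RainbowConnection.exampleG.Connected ∧
      RainbowConnection.exampleH.edgeSet.ncard = 12 ∧
      s(0, 1) ∉ RainbowConnection.exampleH.edgeSet ∧
      RainbowConnection.exampleG.edgeSet = insert s(0, 1) RainbowConnection.exampleH.edgeSet ∧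
      RainbowConnection.src RainbowConnection.exampleH = 4 ∧
      RainbowConnection.srcList RainbowConnection.exampleH = 4 ∧
      5 ≤ RainbowConnection.src RainbowConnection.exampleG ∧
      RainbowConnection.srcList RainbowConnection.exampleH <
        RainbowConnection.srcList RainbowConnection.exampleG) ∧
    -- list rainbow numbers are monotone
    (∀ (W : Type*) [Finite W] (G H : SimpleGraph W), G.Connected → H.Connected → H ≤ G →
      RainbowConnection.rcList G ≤ RainbowConnection.rcList H) := by
  open RainbowConnection in
  have h1 := four_le_src_exampleH
  have h2 := src_le_srcList exampleH_connected
  have h3 := srcList_exampleH_le_four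
  have h4 := five_le_src_exampleG
  have h5 := src_le_srcList exampleG_connected
  have hlt : srcList exampleH < srcList exampleG := by omega
  exact ⟨⟨Fin 10, inferInstance, exampleG, exampleH, exampleG_connected, exampleH_connected,
      exampleH_le_exampleG, hlt⟩,
    ⟨exampleH_connected, exampleG_connected, ncard_edgeSet_exampleH, by decide, edgeSet_exampleG,
      by omega, by omega, h4, hlt⟩,
    fun _ _ _ _ _ hH hle => rcList_anti hH hle⟩
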